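/- Let $n\ge 1$ and $\rho\ge 0$ be integers with $\rho<n/2$, and put $k=n(n-2\rho+1)/2$ if $n$ is odd and $k=(n+1)(n-2\rho)/2$ if $n$ is even. *Graphs.* A binary graph on $n$ nodes is a labelling by $\mathbb F_2$ of all unordered pairs $\{v_i,v_j\}$ of nodes, self loops $i=j$ included; its adjacency matrix is the symmetric matrix of its labels. A binary linear code over graphs of dimension $k$ is a nonempty set of $2^k$ such graphs that is closed under linear combinations. It is $\rho$-node-erasure-correcting if, for every set $F$ of $\rho$ nodes, there is a decoder that recovers every graph of the code from its labels on the edges not incident to $F$. *Array codes.* For an $n\times n$ symmetric binary linear array code $\mathcal C$ (a linear space of symmetric matrices over $\mathbb F_2$), let $\mathcal C_{\mathcal G}$ be the set of all binary graphs on $n$ nodes whose adjacency matrix lies in $\mathcal C$. Schmidt's codes are obtained as follows. Let $m=n$ if $n$ is odd and $m=n+1$ if $n$ is even, let $t=\lfloor (n-2\rho-1)/2\rfloor$, let $\mathrm{Tr}:\mathbb F_{2^m}\to\mathbb F_2$ be the trace, and let $w_1,\dots,w_n\in\mathbb F_{2^m}$ be linearly independent over $\mathbb F_2$. The code consists of all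 matrices $[B_a(w_i,w_j)]_{i,j}$, $a=(a_0,\dots,a_t)\in\mathbb F_{2^m}^{\,t+1}$, where $$B_a(x,y)=\mathrm{Tr}\Big(a_0xy+\sum_{i=1}^{t}a_i\big(xy^{2^i}+x^{2^i}y\big)\Big).$$ **Theorem.** Such codes exist. Every one of them is a $k$-dimensional space $\mathcal C$ of symmetric $n\times n$ matrices over $\mathbb F_2$ in which every nonzero matrix has rank at least $2\rho+1$, and $\mathcal C_{\mathcal G}$ is a binary linear $\rho$-node-erasure-correcting code over graphs of dimension $k$. More generally, for every $k$-dimensional space $\mathcal C$ of symmetric $n\times n$ matrices over $\mathbb F_2$ in which every nonzero matrix has rank at least $2\rho+1$, $\mathcal C_{\mathcal G}$ is a binary linear $\rho$-node-erasure-correcting code over graphs of dimension $k$. -/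

import Mathlib

namespace CodesOverGraphs

/-- An undirected graph on the nodes `v_0, …, v_{n-1}` over the alphabet `S`, regarded as a complete
graph with self loops: a label on every unordered pair of nodes (loops included). -/
abbrev LGraph (n : ℕ) (S : Type*) : Type _ := Sym2 (Fin n) → S

/-- The adjacency matrix `A_G = [L(v_i, v_j)]`. -/
def LGraph.adj {n : ℕ} {S : Type*} (G : LGraph n S) : Matrix (Fin n) (Fin n) S :=
  Matrix.of fun i j => G s(i, j)

/-- A code over graphs (a set of labelled graphs) that is linear of dimension `k` over the ring `S`:
a nonempty set, closed under `α G₁ + β G₂`, with `|S| ^ k` members. -/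
structure IsLinearGraphCode {n : ℕ} {S : Type*} [Ring S] (C : Set (LGraph n S)) (k : ℕ) :
    Prop where
  nonempty : C.Nonempty
  closed : ∀ G₁ ∈ C, ∀ G₂ ∈ C, ∀ α β : S, α • G₁ + β • G₂ ∈ C
  card_eq : Nat.card C = Nat.card S ^ k

open Classical in
/-- What is left of a graph after the nodes in `F` have failed: the label of every edge incident
to a node of `F` is erased (`none`), the other labels are kept. -/
noncomputable def erase {n : ℕ} {S : Type*} (F : Finset (Fin n)) (G : LGraph n S) :
    Sym2 (Fin n) → Option S :=
  fun e => if ∃ v ∈ F, v ∈ e then none else some (G e)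

/-- `C` is a `ρ`-node-erasure-correcting code: for every (known) set of `ρ` failed nodes there is a
decoder that recovers every graph of the code from its non-erased labels. -/
def CorrectsNodeErasures {n : ℕ} {S : Type*} (C : Set (LGraph n S)) (ρ : ℕ) : Prop :=
  ∀ F : Finset (Fin n), F.card = ρ →
    ∃ dec : (Sym2 (Fin n) → Option S) → LGraph n S, ∀ G ∈ C, dec (erase F G) = G

/-- A symmetric linear array code over a field: a `k`-dimensional space of symmetric `n × n`
matrices whose nonzero members have rank at least `d`. -/
structure IsSymmArrayCode {n : ℕ} {K : Type*} [Field K]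
    (C : Submodule K (Matrix (Fin n) (Fin n) K)) (k d : ℕ) : Prop where
  symm : ∀ A ∈ C, A.IsSymm
  finrank_eq : Module.finrank K C = k
  le_rank : ∀ A ∈ C, A ≠ 0 → d ≤ A.rank

/-- The code over graphs of all graphs whose adjacency matrix lies in a given array code. -/
def graphCode {n : ℕ} {K : Type*} [Field K] (C : Submodule K (Matrix (Fin n) (Fin n) K)) :
    Set (LGraph n K) :=
  {G | G.adj ∈ C}

/-- The symmetric bilinear form
`(x, y) ↦ Tr (a_0 x y + ∑_{i=1}^{t} a_i (x y^{2^i} + x^{2^i} y))` on the field with `2 ^ m`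
elements, `Tr` being the absolute trace. -/
noncomputable def schmidtForm {m t : ℕ} (a : Fin (t + 1) → GaloisField 2 m)
    (x y : GaloisField 2 m) : ZMod 2 :=
  Algebra.trace (ZMod 2) (GaloisField 2 m)
    (a 0 * (x * y) +
      ∑ i : Fin t, a i.succ * (x * y ^ 2 ^ (i.val + 1) + x ^ 2 ^ (i.val + 1) * y))

/-- The space of the matrices `[B(w_i, w_j)]`, where `B` runs over the forms `schmidtForm a`. -/
noncomputable def schmidtCode {n m : ℕ} (t : ℕ) (w : Fin n → GaloisField 2 m) :
    Submodule (ZMod 2) (Matrix (Fin n) (Fin n) (ZMod 2)) :=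
  LinearMap.range
    ({ toFun := fun a => Matrix.of fun i j => schmidtForm a (w i) (w j)
       map_add' := by
        intro a b
        ext i j
        simp only [schmidtForm, Matrix.of_apply, Matrix.add_apply, ← map_add]
        congr 1
        simp only [Pi.add_apply, add_mul, Finset.sum_add_distrib]
        ring
       map_smul' := by
        intro c a
        ext i j
        simp only [schmidtForm, Matrix.of_apply, Matrix.smul_apply, RingHom.id_apply, ← map_smul]
        congr 1
        simp only [Pi.smul_apply, smul_mul_assoc, smul_add, Finset.smul_sum] } :
      (Fin (t + 1) → GaloisField 2 m) →ₗ[ZMod 2] Matrix (Fin n) (Fin n) (ZMod 2))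

/-- Schmidt's binary symmetric `n × n` array codes for the minimum rank `2ρ + 1`.
For `n` odd, the forms live on the field with `2 ^ n` elements and are written in an
arbitrary basis; for `n` even, they are the restrictions, to an arbitrary hyperplane with an
arbitrary basis, of the forms on the field with `2 ^ (n + 1)` elements. The number of the
off-diagonal parameters is `t = ⌊(n - 2ρ - 1) / 2⌋`. -/
def IsSchmidtCode (n ρ : ℕ) (C : Submodule (ZMod 2) (Matrix (Fin n) (Fin n) (ZMod 2))) : Prop :=
  ∃ w : Fin n → GaloisField 2 (if Odd n then n else n + 1),
    LinearIndependent (ZMod 2) w ∧ C = schmidtCode ((n - 2 * ρ - 1) / 2) w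

end CodesOverGraphs

namespace CodesOverGraphs

open Polynomial Module

/-! ### Rank bounds for Gram matrices and for matrices supported on a cross. -/

section Rank

variable {K V V₂ V₃ : Type*} [Field K] [AddCommGroup V] [Module K V] [AddCommGroup V₂] [Module K V₂]
  [AddCommGroup V₃] [Module K V₃]

/-! Erasure correction: if two codewords agree off `F`, their difference lives on the rows and
columns of `F`, so it has rank at most `2ρ` and must vanish (`rank_le_of_eq_zero_off_cross`).

Schmidt's codes: Frobenius invariance of the trace gives `B_a(x, y) = Tr (P_a(x) y ^ 2 ^ t)`, with
`P_a` nonzero of degree at most `2 ^ (2t)` when `a ≠ 0`. The radical of `B_a` consists of roots of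
`P_a`, so it has dimension at most `2t` (`finrank_ker_schmidtDual_le`). Passing to `n` independent
vectors costs at most `2(m - n)` in rank (`two_mul_le_rank_gram`), which leaves rank at least `2n -
m - 2t = 2ρ + 1`. In particular `a` is determined by its matrix, whence the dimension `m(t + 1) =
k`. -/

theorem finrank_ker_comp_le [FiniteDimensional K V] [FiniteDimensional K V₂]
    (f : V →ₗ[K] V₂) (g : V₂ →ₗ[K] V₃) :
    finrank K (LinearMap.ker (g ∘ₗ f)) ≤
      finrank K (LinearMap.ker f) + finrank K (LinearMap.ker g) := by
  have hmem : ∀ x ∈ LinearMap.ker (g ∘ₗ f), f x ∈ LinearMap.ker g := fun x hx => hx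
  rw [← LinearMap.finrank_range_add_finrank_ker (f.restrict hmem), add_comm]
  refine add_le_add ?_ (Submodule.finrank_le _)
  let φ : LinearMap.ker (f.restrict hmem) →ₗ[K] LinearMap.ker f :=
    ((Submodule.subtype _).comp (Submodule.subtype _)).codRestrict _ fun x => by
      have hx : f.restrict hmem x.1 = 0 := x.2
      exact congrArg Subtype.val hx
  refine LinearMap.finrank_le_finrank_of_injective (f := φ) fun x y hxy => ?_
  exact Subtype.ext (Subtype.ext (congrArg (fun z : LinearMap.ker f => (z : V)) hxy))

/-- Restricting a bilinear form to the span of `n` independent vectors lowers the rank by at most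
twice the codimension. -/
theorem two_mul_le_rank_gram [FiniteDimensional K V] {n : ℕ} (B : V →ₗ[K] Dual K V)
    {w : Fin n → V} (hw : LinearIndependent K w) :
    2 * n ≤ (Matrix.of fun i j => B (w j) (w i)).rank + finrank K (LinearMap.ker B) +
      finrank K V := by
  set M : Matrix (Fin n) (Fin n) K := Matrix.of fun i j => B (w j) (w i) with hM
  let ι : (Fin n → K) →ₗ[K] V := Fintype.linearCombination K w
  have hι : LinearMap.ker ι = ⊥ := LinearMap.ker_eq_bot.2 hw.fintypeLinearCombination_injective
  let D : Dual K V →ₗ[K] (Fin n → K) := LinearMap.pi fun i => Dual.eval K V (w i)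
  have hD : LinearMap.range D = ⊤ := by
    obtain ⟨g, hg⟩ := ι.exists_leftInverse_of_injective hι
    rw [LinearMap.range_eq_top]
    intro v
    refine ⟨(Fintype.linearCombination K v) ∘ₗ g, funext fun i => ?_⟩
    have hwi : ι (Pi.single i 1) = w i := by simp [ι]
    have hgi : g (w i) = Pi.single i 1 := by
      rw [← hwi]; exact LinearMap.congr_fun hg _
    simp [D, hgi]
  -- The kernel of this composite is bounded by the sum of the three kernels, of dimensions `0`,
  -- `dim ker B` and `dim V - n`.
  have hcomp : M.mulVecLin = D ∘ₗ B ∘ₗ ι := by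
    refine LinearMap.ext fun c => funext fun i => ?_
    simp [M, D, ι, Matrix.mulVec, dotProduct, Fintype.linearCombination_apply, mul_comm]
  have hr := LinearMap.finrank_range_add_finrank_ker M.mulVecLin
  have hDr := LinearMap.finrank_range_add_finrank_ker D
  have h1 := finrank_ker_comp_le (B ∘ₗ ι) D
  have h2 := finrank_ker_comp_le ι B
  rw [hι, finrank_bot] at h2
  rw [hD, finrank_top, Subspace.dual_finrank_eq] at hDr
  rw [← hcomp] at h1
  simp only [finrank_fin_fun] at hr hDr
  change M.rank + _ = n at hr
  omega

theorem rank_add_le {n : ℕ} (A B : Matrix (Fin n) (Fin n) K) :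
    (A + B).rank ≤ A.rank + B.rank := by
  refine le_trans (Submodule.finrank_mono ?_)
    (Submodule.finrank_add_le_finrank_add_finrank (LinearMap.range A.mulVecLin)
      (LinearMap.range B.mulVecLin))
  rw [Matrix.mulVecLin_add]
  exact LinearMap.range_add_le _ _

/-- The rows in `F`, and the columns in `F` of what remains, each factor through a diagonal
projection of rank `|F|`. -/
theorem rank_le_of_eq_zero_off_cross {n : ℕ} (A : Matrix (Fin n) (Fin n) K) (F : Finset (Fin n))
    (hA : ∀ i j, i ∉ F → j ∉ F → A i j = 0) : A.rank ≤ 2 * F.card := by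
  classical
  let d : Fin n → K := fun i => if i ∈ F then 1 else 0
  have hd : (Matrix.diagonal d).rank ≤ F.card := by
    rw [Matrix.rank_diagonal]
    simp [d, Fintype.card_subtype]
  have hdec : A = Matrix.diagonal d * A + (A - Matrix.diagonal d * A) * Matrix.diagonal d := by
    ext i j
    simp only [Matrix.add_apply, Matrix.diagonal_mul, Matrix.mul_diagonal, Matrix.sub_apply, d]
    by_cases hi : i ∈ F <;> by_cases hj : j ∈ F <;> simp [hi, hj]
    exact hA i j hi hj
  have h1 := Matrix.rank_mul_le_left (Matrix.diagonal d) A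
  have h2 := Matrix.rank_mul_le_right (A - Matrix.diagonal d * A) (Matrix.diagonal d)
  have h3 := rank_add_le (Matrix.diagonal d * A)
    ((A - Matrix.diagonal d * A) * Matrix.diagonal d)
  rw [← hdec] at h3
  omega

end Rank

/-! ### From rank distance to node erasures. -/

section GraphCode

variable {n : ℕ} {K : Type*} [Field K] {C : Submodule K (Matrix (Fin n) (Fin n) K)}

theorem LGraph.adj_injective {n : ℕ} {S : Type*} :
    Function.Injective (LGraph.adj : LGraph n S → Matrix (Fin n) (Fin n) S) := by
  intro G H h
  funext e
  induction e with
  | h i j => exact congrFun (congrFun h i) j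

/-- A space of symmetric matrices is in bijection with its code over graphs. -/
def graphCodeEquiv (hC : ∀ A ∈ C, A.IsSymm) : graphCode C ≃ C where
  toFun G := ⟨LGraph.adj G.1, G.2⟩
  invFun A := ⟨Sym2.lift ⟨fun i j => A.1 i j, fun i j => (hC A.1 A.2).apply j i⟩, A.2⟩
  left_inv _ := Subtype.ext (LGraph.adj_injective rfl)
  right_inv _ := rfl

theorem IsSymmArrayCode.isLinearGraphCode {k d : ℕ} (h : IsSymmArrayCode C k d) :
    IsLinearGraphCode (graphCode C) k where
  nonempty := ⟨0, C.zero_mem⟩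
  closed G₁ h₁ G₂ h₂ α β := C.add_mem (C.smul_mem α h₁) (C.smul_mem β h₂)
  card_eq := by
    rw [Nat.card_congr (graphCodeEquiv h.symm), Module.natCard_eq_pow_finrank (K := K),
      h.finrank_eq]

theorem IsSymmArrayCode.correctsNodeErasures {k ρ : ℕ} (h : IsSymmArrayCode C k (2 * ρ + 1)) :
    CorrectsNodeErasures (graphCode C) ρ := by
  intro F hF
  -- Injectivity of erasure on the code suffices: the decoder is any inverse on the image.
  have hinj : Set.InjOn (erase F) (graphCode C) := by
    intro G hG H hH hGH
    by_contra hne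
    have hsub : G.adj - H.adj ≠ 0 := fun h0 => hne (LGraph.adj_injective (sub_eq_zero.1 h0))
    have hle := h.le_rank _ (C.sub_mem hG hH) hsub
    have hrank := rank_le_of_eq_zero_off_cross (G.adj - H.adj) F fun i j hi hj => by
      have hij := congrFun hGH s(i, j)
      have hnot : ¬ ∃ v ∈ F, v ∈ s(i, j) := by
        rintro ⟨v, hv, hvm⟩
        rcases Sym2.mem_iff.1 hvm with rfl | rfl
        exacts [hi hv, hj hv]
      simp only [erase, if_neg hnot, Option.some.injEq] at hij
      exact sub_eq_zero.2 hij
    omega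
  exact ⟨Function.invFunOn (erase F) (graphCode C), fun G hG => hinj.leftInvOn_invFunOn hG⟩

end GraphCode

/-! ### Ranks of Schmidt's trace forms. -/

section Schmidt

variable {m t : ℕ}

/-- The linearized polynomial `P` with `schmidtForm a x y = Tr (P(x) y ^ 2 ^ t)`. -/
noncomputable def schmidtPoly (a : Fin (t + 1) → GaloisField 2 m) : (GaloisField 2 m)[X] :=
  C (a 0 ^ 2 ^ t) * X ^ 2 ^ t +
    ∑ i : Fin t, (C (a i.succ ^ 2 ^ (t - (i.val + 1))) * X ^ 2 ^ (t - (i.val + 1)) +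
      C (a i.succ ^ 2 ^ t) * X ^ 2 ^ (t + (i.val + 1)))

theorem trace_pow_two_pow (s : ℕ) (x : GaloisField 2 m) :
    Algebra.trace (ZMod 2) (GaloisField 2 m) (x ^ 2 ^ s) =
      Algebra.trace (ZMod 2) (GaloisField 2 m) x := by
  induction s with
  | zero => simp
  | succ s ih =>
    rw [pow_succ, pow_mul, ← ih]
    have := Algebra.trace_eq_of_algEquiv
      (FiniteField.frobeniusAlgEquivOfAlgebraic (ZMod 2) (GaloisField 2 m)) (x ^ 2 ^ s)
    simpa [FiniteField.coe_frobeniusAlgEquivOfAlgebraic, ZMod.card] using this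

/-- Inside the trace, each monomial is raised to the power of `2` that turns its factor in `y` into
`y ^ 2 ^ t`: `2 ^ (t - i)` for `a_i x y ^ 2 ^ i`, and `2 ^ t` for the others. -/
theorem schmidtForm_eq_trace (a : Fin (t + 1) → GaloisField 2 m) (x y : GaloisField 2 m) :
    schmidtForm a x y =
      Algebra.trace (ZMod 2) (GaloisField 2 m) ((schmidtPoly a).eval x * y ^ 2 ^ t) := by
  simp only [schmidtForm, schmidtPoly, eval_add, eval_mul, eval_C, eval_pow, eval_X,
    eval_finsetSum, add_mul, Finset.sum_mul, mul_add, map_add, map_sum]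
  congr 1
  · rw [← trace_pow_two_pow t]
    congr 1
    ring
  · refine Finset.sum_congr rfl fun i _ => ?_
    congr 1
    · rw [← trace_pow_two_pow (t - (i.val + 1))]
      congr 1
      have : 2 ^ t = 2 ^ (i.val + 1) * 2 ^ (t - (i.val + 1)) := by
        rw [← pow_add]; congr 1; omega
      rw [this, mul_pow, mul_pow, ← pow_mul y, mul_assoc]
    · rw [← trace_pow_two_pow t]
      congr 1
      rw [mul_pow, mul_pow, ← pow_mul x, ← pow_add, add_comm (i.val + 1) t, mul_assoc]

theorem natDegree_schmidtPoly_le (a : Fin (t + 1) → GaloisField 2 m) :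
    (schmidtPoly a).natDegree ≤ 2 ^ (2 * t) := by
  have hpow : ∀ {s : ℕ} (c : GaloisField 2 m), s ≤ 2 * t →
      (C c * X ^ 2 ^ s).natDegree ≤ 2 ^ (2 * t) := fun c hs =>
    (natDegree_C_mul_X_pow_le c _).trans (Nat.pow_le_pow_right two_pos hs)
  refine natDegree_add_le_of_degree_le (hpow _ (by omega)) ?_
  refine natDegree_sum_le_of_forall_le _ _ fun i _ => ?_
  exact natDegree_add_le_of_degree_le (hpow _ (by omega)) (hpow _ (by omega))

theorem schmidtPoly_ne_zero {a : Fin (t + 1) → GaloisField 2 m} (ha : a ≠ 0) :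
    schmidtPoly a ≠ 0 := by
  have hinj : ∀ r s : ℕ, 2 ^ r = 2 ^ s ↔ r = s := fun r s => Nat.pow_right_inj one_lt_two
  refine fun h => ha (funext fun j => ?_)
  -- The exponents `t`, `t - i`, `t + i` are pairwise distinct, so this coefficient is exactly `a_j
  -- ^ 2 ^ t`.
  have hj := congrArg (fun p => coeff p (2 ^ (t + j.val))) h
  simp only [schmidtPoly, coeff_add, finsetSum_coeff, coeff_C_mul, coeff_X_pow, hinj,
    coeff_zero, mul_ite, mul_one, mul_zero] at hj
  cases j using Fin.cases with
  | zero =>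
    rw [if_pos (by simp), Finset.sum_eq_zero, add_zero] at hj
    · exact pow_eq_zero_iff (by positivity) |>.1 hj
    · intro i _
      rw [if_neg, if_neg, add_zero] <;> simp only [Fin.val_zero] <;> omega
  | succ j =>
    rw [if_neg (by simp), zero_add, Finset.sum_eq_single j, if_neg, if_pos (by simp), zero_add]
      at hj
    · exact pow_eq_zero_iff (by positivity) |>.1 hj
    · simp only [Fin.val_succ]; omega
    · intro i _ hij
      have := Fin.val_ne_of_ne hij
      rw [if_neg, if_neg, add_zero] <;> simp only [Fin.val_succ] <;> omega
    · simp

theorem schmidtForm_comm (a : Fin (t + 1) → GaloisField 2 m) (x y : GaloisField 2 m) :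
    schmidtForm a x y = schmidtForm a y x := by
  simp only [schmidtForm]
  congr 1
  rw [mul_comm x y]
  congr 1
  exact Finset.sum_congr rfl fun i _ => by ring

/-- `schmidtForm a` as a map into the dual space. -/
noncomputable def schmidtDual (a : Fin (t + 1) → GaloisField 2 m) :
    GaloisField 2 m →ₗ[ZMod 2] Dual (ZMod 2) (GaloisField 2 m) :=
  have hadd : ∀ x x' y, schmidtForm a (x + x') y = schmidtForm a x y + schmidtForm a x' y := by
    intro x x' y
    simp only [schmidtForm, ← map_add]
    congr 1
    simp only [add_pow_char_pow, add_mul, mul_add, Finset.sum_add_distrib]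
    ring
  have hsmul : ∀ (c : ZMod 2) x y, schmidtForm a (c • x) y = c • schmidtForm a x y := by
    intro c x y
    have hc : ∀ c : ZMod 2, c = 0 ∨ c = 1 := by decide
    rcases hc c with rfl | rfl
    · simp [schmidtForm]
    · simp only [one_smul]
  LinearMap.mk₂ (ZMod 2) (schmidtForm a) hadd hsmul
    (fun x y y' => by simp only [schmidtForm_comm a x, hadd])
    (fun c x y => by simp only [schmidtForm_comm a x, hsmul])

theorem finrank_ker_schmidtDual_le {a : Fin (t + 1) → GaloisField 2 m} (ha : a ≠ 0) :
    finrank (ZMod 2) (LinearMap.ker (schmidtDual a)) ≤ 2 * t := by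
  classical
  have hroot : ∀ x ∈ LinearMap.ker (schmidtDual a), x ∈ (schmidtPoly a).roots.toFinset := by
    intro x hx
    rw [Multiset.mem_toFinset, mem_roots (schmidtPoly_ne_zero ha), IsRoot.def]
    refine (traceForm_nondegenerate (ZMod 2) (GaloisField 2 m)).1 _ fun z => ?_
    -- Every `z` is some `y ^ 2 ^ t`, so `P_a(x)` is trace-orthogonal to the whole field.
    obtain ⟨y, rfl⟩ := (bijective_iterateFrobenius (R := GaloisField 2 m) (p := 2) (n := t)).2 z
    rw [iterateFrobenius_def, Algebra.traceForm_apply, ← schmidtForm_eq_trace]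
    exact LinearMap.congr_fun hx y
  have hcard : Nat.card (LinearMap.ker (schmidtDual a)) ≤ 2 ^ (2 * t) := by
    calc Nat.card (LinearMap.ker (schmidtDual a))
        ≤ Nat.card ((schmidtPoly a).roots.toFinset) :=
          Nat.card_le_card_of_injective (fun x => ⟨x.1, hroot x.1 x.2⟩) fun x y hxy =>
            Subtype.ext (Subtype.mk.inj hxy)
      _ ≤ (schmidtPoly a).roots.card := by
          rw [Nat.card_eq_fintype_card, Fintype.card_coe]
          exact Multiset.toFinset_card_le _
      _ ≤ 2 ^ (2 * t) := (card_roots' _).trans (natDegree_schmidtPoly_le a)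
  rw [Module.natCard_eq_pow_finrank (K := ZMod 2), Nat.card_zmod] at hcard
  exact (Nat.pow_le_pow_iff_right one_lt_two).1 hcard

theorem two_mul_le_rank_schmidtForm {n : ℕ} (hm : m ≠ 0) {w : Fin n → GaloisField 2 m}
    (hw : LinearIndependent (ZMod 2) w) {a : Fin (t + 1) → GaloisField 2 m} (ha : a ≠ 0) :
    2 * n ≤ (Matrix.of fun i j => schmidtForm a (w i) (w j)).rank + 2 * t + m := by
  have h := two_mul_le_rank_gram (schmidtDual a) hw
  have hM : (Matrix.of fun i j => schmidtDual a (w j) (w i)) =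
      Matrix.of fun i j => schmidtForm a (w i) (w j) := by
    ext i j
    exact schmidtForm_comm a _ _
  rw [hM, GaloisField.finrank 2 hm] at h
  have := finrank_ker_schmidtDual_le ha
  omega

theorem isSymmArrayCode_schmidtCode {n d : ℕ} (hm : m ≠ 0) {w : Fin n → GaloisField 2 m}
    (hw : LinearIndependent (ZMod 2) w) (hd : 0 < d) (hle : d + 2 * t + m ≤ 2 * n) :
    IsSymmArrayCode (schmidtCode t w) (m * (t + 1)) d where
  symm := by
    rintro _ ⟨a, rfl⟩
    exact Matrix.IsSymm.ext fun i j => schmidtForm_comm a _ _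
  finrank_eq := by
    rw [schmidtCode, LinearMap.finrank_range_of_inj, Module.finrank_pi_fintype]
    · simp [GaloisField.finrank 2 hm, mul_comm]
    -- A nonzero parameter vector gives rank at least `d > 0`, hence a nonzero matrix.
    · rw [← LinearMap.ker_eq_bot, LinearMap.ker_eq_bot']
      intro a ha
      by_contra hne
      have h := two_mul_le_rank_schmidtForm hm hw hne
      change (Matrix.of fun i j => schmidtForm a (w i) (w j)) = 0 at ha
      rw [ha, Matrix.rank_zero] at h
      omega
  le_rank := by
    rintro _ ⟨a, rfl⟩ hne
    have ha : a ≠ 0 := fun h0 => hne (by rw [h0, map_zero])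
    have h : 2 * n ≤ _ := two_mul_le_rank_schmidtForm hm hw ha
    refine le_trans ?_ (show (Matrix.of fun i j => schmidtForm a (w i) (w j)).rank ≤ _ from le_rfl)
    omega

end Schmidt

theorem IsSchmidtCode.isSymmArrayCode {n ρ k : ℕ} (hρ : 2 * ρ < n)
    (hk : k = if Odd n then n * (n - 2 * ρ + 1) / 2 else (n + 1) * (n - 2 * ρ) / 2)
    {C : Submodule (ZMod 2) (Matrix (Fin n) (Fin n) (ZMod 2))} (hC : IsSchmidtCode n ρ C) :
    IsSymmArrayCode C k (2 * ρ + 1) := by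
  obtain ⟨w, hw, rfl⟩ := hC
  have hkm : k = (if Odd n then n else n + 1) * ((n - 2 * ρ - 1) / 2 + 1) := by
    rw [hk]
    split_ifs with h
    · obtain ⟨s, rfl⟩ := h
      rw [show 2 * s + 1 - 2 * ρ + 1 = 2 * ((2 * s + 1 - 2 * ρ - 1) / 2 + 1) by omega,
        mul_left_comm, Nat.mul_div_cancel_left _ two_pos]
    · obtain ⟨s, rfl⟩ := Nat.not_odd_iff_even.1 h
      rw [show s + s - 2 * ρ = 2 * ((s + s - 2 * ρ - 1) / 2 + 1) by omega,
        mul_left_comm, Nat.mul_div_cancel_left _ two_pos]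
      congr 2
      omega
  rw [hkm]
  refine isSymmArrayCode_schmidtCode (by split_ifs <;> omega) hw (by omega) ?_
  -- By parity the floor defining `t` makes this bound an equality in both cases.
  split_ifs with h
  · obtain ⟨s, rfl⟩ := h
    omega
  · obtain ⟨s, rfl⟩ := Nat.not_odd_iff_even.1 h
    omega

theorem exists_isSchmidtCode {n : ℕ} (ρ : ℕ) (hn : n ≠ 0) :
    ∃ C : Submodule (ZMod 2) (Matrix (Fin n) (Fin n) (ZMod 2)), IsSchmidtCode n ρ C := by
  obtain ⟨w, hw⟩ := exists_linearIndependent_of_le_finrank (R := ZMod 2)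
    (M := GaloisField 2 (if Odd n then n else n + 1)) (n := n) (by
      rw [GaloisField.finrank 2 (by split_ifs <;> omega)]
      split_ifs <;> omega)
  exact ⟨_, w, hw, rfl⟩

end CodesOverGraphs

theorem mainTheorem2 (n ρ : ℕ) (hρ : 2 * ρ < n) (k : ℕ)
    (hk : k = if Odd n then n * (n - 2 * ρ + 1) / 2 else (n + 1) * (n - 2 * ρ) / 2) :
    (∃ C : Submodule (ZMod 2) (Matrix (Fin n) (Fin n) (ZMod 2)),
      CodesOverGraphs.IsSchmidtCode n ρ C) ∧
    (∀ C : Submodule (ZMod 2) (Matrix (Fin n) (Fin n) (ZMod 2)),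
      CodesOverGraphs.IsSchmidtCode n ρ C →
        CodesOverGraphs.IsSymmArrayCode C k (2 * ρ + 1) ∧
        CodesOverGraphs.IsLinearGraphCode (CodesOverGraphs.graphCode C) k ∧
        CodesOverGraphs.CorrectsNodeErasures (CodesOverGraphs.graphCode C) ρ) ∧
    (∀ C : Submodule (ZMod 2) (Matrix (Fin n) (Fin n) (ZMod 2)),
      CodesOverGraphs.IsSymmArrayCode C k (2 * ρ + 1) →
        CodesOverGraphs.IsLinearGraphCode (CodesOverGraphs.graphCode C) k ∧
        CodesOverGraphs.CorrectsNodeErasures (CodesOverGraphs.graphCode C) ρ) := by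
  refine ⟨CodesOverGraphs.exists_isSchmidtCode ρ (by omega), fun C hC => ?_, fun C hC =>
    ⟨hC.isLinearGraphCode, hC.correctsNodeErasures⟩⟩
  have h := hC.isSymmArrayCode hρ hk
  exact ⟨h, h.isLinearGraphCode, h.correctsNodeErasures⟩
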